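/- **Definitions.** Let $\alpha,\beta$ be reals. Write $\mathrm{LC}(\beta)=\{q\in\mathbb{Q}: 0\le q<\beta\}$. A *$\mathbb{Q}$-translation function* from $\beta$ to $\alpha$ is a partial computable function $g$ from $\mathbb{Q}\cap[0,1)$ to itself such that for every $q\in\mathrm{LC}(\beta)$ the value $g(q)$ is defined and satisfies $g(q)<\alpha$, and $g(q)\to\alpha$ as $q\to\beta$ with $q\in\mathrm{LC}(\beta)$ (an empty condition if $\mathrm{LC}(\beta)=\emptyset$). We say that $\alpha$ is *Solovay reducible* to $\beta$, written $\alpha\le_{\mathrm S}\beta$, if there are a real constant $c$ and a $\mathbb{Q}$-translation function $g$ from $\beta$ to $\alpha$ with $\alpha-g(q)<c(\beta-q)$ for all $q\in\mathrm{LC}(\beta)$; it is *total Solovay reducible* to $\beta$, written $\alpha\le_{\mathrm S}^{\mathrm{tot}}\beta$, if moreover such a $g$ can be chosen that is defined on all of $\mathbb{Q}\cap[0,1)$. An *effective approximation* of a real $x$ is a sequence $(q_n)_{n\ge 0}$ of rationals with $|q_n-q_{n+1}|<2^{-n}$ for all $n$ and $\lim_n q_n=x$. A real is *computable* if it has a computable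 effective approximation. A real function $f$ is *computable on* a set $X\subseteq\mathrm{dom}(f)$ if there is a single oracle machine that, for every $x\in X$ and every effective approximation of $x$ given as oracle, returns an effective approximation of $f(x)$. A *weakly $\mathbb{R}$-translation function* from $\beta$ to $\alpha$ is a real function $f$ that is computable on $[0,\beta)$ and satisfies $f(x)\to\alpha$ as $x\to\beta$ with $x\in[0,\beta)$; it is an *$\mathbb{R}$-translation function* if moreover it maps $[0,\beta)$ to $[0,\alpha)$. Now $\alpha$ is * *computably Lipschitz reducible to $\beta$ on a c.e. open interval*, written $\alpha\le_{\mathrm{cL}}^{\mathrm{open}}\beta$, if there is a weakly $\mathbb{R}$-translation function from $\beta$ to $\alpha$ that is Lipschitz continuous on $[0,\beta)$; * *real Solovay reducible to $\beta$*, written $\alpha\le_{\mathrm S}^{\mathbb{R}}\beta$, if there is an $\mathbb{R}$-translation function from $\beta$ to $\alpha$ that is Lipschitz continuous on $[0,\beta)$; * *computably Lipschitz reducible to $\beta$ locally*, written $\alpha\le_{\mathrm{cL}}^{\mathrm{loc}}\beta$, if there are a real $b>\beta$ and a real function $f$ that is Lipschitz continuous and computable on $[0,b]$ with $f(\beta)=\alpha$.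 **Theorem.** For all reals $\alpha$ and $\beta$: 1. $\alpha\le_{\mathrm S}\beta$ implies $\alpha\le_{\mathrm{cL}}^{\mathrm{open}}\beta$; 2. if $\beta>0$, then $\alpha\le_{\mathrm S}^{\mathrm{tot}}\beta$ implies $\alpha\le_{\mathrm{cL}}^{\mathrm{loc}}\beta$; 3. if $\alpha$ is not computable, then $\alpha\le_{\mathrm S}\beta$ implies $\alpha\le_{\mathrm S}^{\mathbb{R}}\beta$. -/

import Mathlib

open Filter Topology
open scoped NNReal

namespace SolovayVariants

/-! ### Rationals as inputs and outputs of computations -/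

/-- The code of a rational: the pair of its reduced numerator and denominator. -/
def ratCode (q : ℚ) : ℕ := Nat.pair (Encodable.encode q.num) q.den

/-- A partial function on the rationals is partial computable if some partial recursive function
computes it on codes: it halts on the code of `q` exactly if `g q` is defined, and then returns the
code of `g q`. -/
def PartialComputable (g : ℚ →. ℚ) : Prop :=
  ∃ φ : ℕ →. ℕ, Nat.Partrec φ ∧ ∀ q : ℚ, φ (ratCode q) = (g q).map ratCode

/-- A sequence of rationals is computable if the sequence of the codes is. -/
def ComputableSeq (q : ℕ → ℚ) : Prop :=
  Computable fun n => ratCode (q n)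

/-! ### Solovay reducibility via functions on the rationals -/

/-- The left cut of `β`: the rationals `q` with `0 ≤ q < β`. -/
def leftCut (β : ℝ) : Set ℚ := {q | 0 ≤ q ∧ (q : ℝ) < β}

/-- `g` is a `ℚ`-translation function from `β` to `α`: a partial computable function from
`ℚ ∩ [0,1)` to itself, defined and below `α` on the left cut of `β`, with left limit `α` at `β`. -/
structure IsQTranslation (g : ℚ →. ℚ) (β α : ℝ) : Prop where
  partialComputable : PartialComputable g
  mem_unit : ∀ q r : ℚ, r ∈ g q → q ∈ Set.Ico (0 : ℚ) 1 ∧ r ∈ Set.Ico (0 : ℚ) 1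
  dom_of_mem_leftCut : ∀ q ∈ leftCut β, (g q).Dom
  lt_of_mem_leftCut : ∀ q ∈ leftCut β, ∀ r ∈ g q, (r : ℝ) < α
  left_limit : ∀ ε : ℝ, 0 < ε → ∃ δ : ℝ, 0 < δ ∧
    ∀ q ∈ leftCut β, β - δ < (q : ℝ) → ∀ r ∈ g q, |(r : ℝ) - α| < ε

/-- `α` is Solovay reducible to `β` via `g`. -/
def SolovayReducibleVia (g : ℚ →. ℚ) (α β : ℝ) : Prop :=
  IsQTranslation g β α ∧
    ∃ c : ℝ, ∀ q ∈ leftCut β, ∀ r ∈ g q, α - (r : ℝ) < c * (β - (q : ℝ))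

/-- Solovay reducibility. -/
def SolovayReducible (α β : ℝ) : Prop :=
  ∃ g : ℚ →. ℚ, SolovayReducibleVia g α β

/-- Total Solovay reducibility: the translation function is defined on all of `ℚ ∩ [0,1)`. -/
def TotalSolovayReducible (α β : ℝ) : Prop :=
  ∃ g : ℚ →. ℚ, SolovayReducibleVia g α β ∧ ∀ q ∈ Set.Ico (0 : ℚ) 1, (g q).Dom

/-! ### Oracle machines and computable real functions -/

/-- Programs of oracle machines: the programs for partial recursive functions, together with an
instruction that queries the oracle. -/
inductive OracleMachine : Type
  | zero : OracleMachine
  | succ : OracleMachine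
  | left : OracleMachine
  | right : OracleMachine
  | oracle : OracleMachine
  | pair : OracleMachine → OracleMachine → OracleMachine
  | comp : OracleMachine → OracleMachine → OracleMachine
  | prec : OracleMachine → OracleMachine → OracleMachine
  | rfind : OracleMachine → OracleMachine

/-- The partial function computed by an oracle machine with the oracle `O`. -/
def OracleMachine.eval (O : ℕ → ℕ) : OracleMachine → ℕ →. ℕ
  | .zero => fun _ => Part.some 0
  | .succ => fun n => Part.some (n + 1)
  | .left => fun n => Part.some n.unpair.1
  | .right => fun n => Part.some n.unpair.2
  | .oracle => fun n => Part.some (O n)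
  | .pair M N => fun n => (M.eval O n).bind fun a => (N.eval O n).map fun b => Nat.pair a b
  | .comp M N => fun n => (N.eval O n).bind (M.eval O)
  | .prec M N => fun k =>
      Nat.rec (M.eval O k.unpair.1)
        (fun y IH => IH.bind fun i => N.eval O (Nat.pair k.unpair.1 (Nat.pair y i))) k.unpair.2
  | .rfind M => fun a => Nat.rfind fun n => (M.eval O (Nat.pair a n)).map fun m => decide (m = 0)

/-- `M`, used as a Type 2 machine, returns the infinite sequence `q` from the input sequence `p`. -/
def OracleMachine.Returns (M : OracleMachine) (p q : ℕ → ℚ) : Prop :=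
  ∀ n : ℕ, ratCode (q n) ∈ M.eval (fun k => ratCode (p k)) n

/-- `q` is an effective approximation of the real `x`. -/
def IsEffectiveApprox (q : ℕ → ℚ) (x : ℝ) : Prop :=
  (∀ n : ℕ, |q n - q (n + 1)| < (1 / 2 : ℚ) ^ n) ∧ Tendsto (fun n => (q n : ℝ)) atTop (𝓝 x)

/-- A real is computable if it has a computable effective approximation. -/
def ComputableReal (x : ℝ) : Prop :=
  ∃ q : ℕ → ℚ, ComputableSeq q ∧ IsEffectiveApprox q x

/-- The real function `f` is computable on `X`: one machine turns every effective approximation of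
every `x ∈ X` into an effective approximation of `f x`. -/
def ComputableOn (f : ℝ → ℝ) (X : Set ℝ) : Prop :=
  ∃ M : OracleMachine, ∀ x ∈ X, ∀ p : ℕ → ℚ, IsEffectiveApprox p x →
    ∃ q : ℕ → ℚ, M.Returns p q ∧ IsEffectiveApprox q (f x)

/-! ### Reducibilities via functions on the reals -/

/-- `f` is a weakly `ℝ`-translation function from `β` to `α`. Only the values of `f` on `[0,β)`
matter. -/
structure IsWeakRTranslation (f : ℝ → ℝ) (β α : ℝ) : Prop where
  computableOn : ComputableOn f (Set.Ico 0 β)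
  left_limit : Tendsto f (𝓝[Set.Ico 0 β] β) (𝓝 α)

/-- `f` is an `ℝ`-translation function from `β` to `α`: in addition it maps `[0,β)` to `[0,α)`. -/
structure IsRTranslation (f : ℝ → ℝ) (β α : ℝ) : Prop extends IsWeakRTranslation f β α where
  mapsTo : Set.MapsTo f (Set.Ico 0 β) (Set.Ico 0 α)

/-- Real Solovay reducibility of `α` to `β`. -/
def RealSolovayReducible (α β : ℝ) : Prop :=
  ∃ f : ℝ → ℝ, IsRTranslation f β α ∧ ∃ K : ℝ≥0, LipschitzOnWith K f (Set.Ico 0 β)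

/-- Computable Lipschitz reducibility of `α` to `β` on a c.e. open interval. -/
def CLOpenReducible (α β : ℝ) : Prop :=
  ∃ f : ℝ → ℝ, IsWeakRTranslation f β α ∧ ∃ K : ℝ≥0, LipschitzOnWith K f (Set.Ico 0 β)

/-- Local computable Lipschitz reducibility of `α` to `β`. -/
def CLLocalReducible (α β : ℝ) : Prop :=
  ∃ b : ℝ, β < b ∧ ∃ f : ℝ → ℝ, ComputableOn f (Set.Icc 0 b) ∧
    (∃ K : ℝ≥0, LipschitzOnWith K f (Set.Icc 0 b)) ∧ f β = α

end SolovayVariants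

namespace SolovayVariants

/-! ### Grid functions with controlled increments -/

/-! A Solovay reduction `g` with constant `c` only gives values at rationals, and they may jump
wildly. These values are regularised into one real function, which serves all three claims. On the
grid of mesh `2^(-n)` the rounded values of `g` are clamped so that neighbouring values increase by
between `0` and `c` units of `2^(-n)`, and so that each level stays within `O(c)` units of the
previous one. The levels therefore converge geometrically to a monotone, `c`-Lipschitz function
`gridLimit`.

Clamping preserves the two facts that matter to the left of `β`: values stay below `α`
(`gridVal_lt`), and they stay above the line `α - c(β - x)` up to one unit of rounding
(`le_gridVal`). Hence the limit function tends to `α` at `β`.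

A grid value depends only on data at points to its left. So it can be computed on `[0,β)` even
though `g` may diverge beyond `β` (`exists_partrec_gridVal`): from an approximation of `x` one reads
off a grid point safely left of `x` (`exists_partrec_gridLimit`). If `g` is total, the same
algorithm works past `β`, and continuity gives the value `α` at `β`. If the limit function reached
`α` before `β`, monotonicity would make it equal to `α` at a rational, so `α` would be computable.
This gives strictness for noncomputable `α`. -/

/-- The value at a new grid point: `v` clamped first to `[2u, 2u + c + 1]`, where `u` is the value
on the coarser grid, and then to `[l, l + c]`, where `l` is the value at the left neighbour. -/
def gridStep (c u l v : ℕ) : ℕ :=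
  max l (min (max (2 * u) (min v (2 * u + c + 1))) (l + c))

/-- `gridVal G c n j` is `2 ^ n` times the value of the `n`-th approximation at `j / 2 ^ n`. -/
def gridVal (G : ℕ → ℕ → ℕ) (c : ℕ) : ℕ → ℕ → ℕ
  | 0, _ => 0
  | _ + 1, 0 => 0
  | n + 1, j + 1 =>
      gridStep c (gridVal G c n ((j + 1) / 2)) (gridVal G c (n + 1) j) (G (n + 1) (j + 1))
  termination_by n j => (n, j)

section Grid

variable {G : ℕ → ℕ → ℕ} {c : ℕ}

lemma gridVal_zero_left (j : ℕ) : gridVal G c 0 j = 0 := by rw [gridVal]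

lemma gridVal_zero_right (n : ℕ) : gridVal G c n 0 = 0 := by cases n <;> rw [gridVal]

lemma gridVal_succ_succ (n j : ℕ) : gridVal G c (n + 1) (j + 1) =
    gridStep c (gridVal G c n ((j + 1) / 2)) (gridVal G c (n + 1) j) (G (n + 1) (j + 1)) := by
  rw [gridVal]

lemma gridVal_le_succ (n j : ℕ) : gridVal G c n j ≤ gridVal G c n (j + 1) := by
  cases n with
  | zero => simp [gridVal_zero_left]
  | succ n => rw [gridVal_succ_succ]; exact le_max_left _ _

lemma gridVal_mono (n : ℕ) : Monotone (gridVal G c n) := monotone_nat_of_le_succ (gridVal_le_succ n)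

lemma gridVal_succ_le (n j : ℕ) : gridVal G c n (j + 1) ≤ gridVal G c n j + c := by
  cases n with
  | zero => simp [gridVal_zero_left]
  | succ n => rw [gridVal_succ_succ, gridStep]; omega

lemma gridVal_add_le (n j k : ℕ) : gridVal G c n (j + k) ≤ gridVal G c n j + c * k := by
  induction k with
  | zero => simp
  | succ k ih =>
    have := gridVal_succ_le (G := G) (c := c) n (j + k)
    rw [← add_assoc, mul_add]; omega

lemma gridVal_succ_le_coarse (n j : ℕ) :
    gridVal G c (n + 1) j ≤ 2 * gridVal G c n (j / 2) + c + 1 := by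
  induction j with
  | zero => simp [gridVal_zero_right]
  | succ j ih =>
    have := gridVal_mono (G := G) (c := c) n (Nat.div_le_div_right (c := 2) (Nat.le_succ j))
    rw [gridVal_succ_succ, gridStep]
    simp only [Nat.succ_eq_add_one] at this
    omega

/-- The cap `l + c` can keep a fine value below `2u`. Across one coarse step `2u` grows by at most
`2c`, while two fine steps allow exactly `2c`. So a deficit of at most `c` arises at an even point
and is made up at the next odd point; the two bounds feed each other in the induction. -/
lemma coarse_le_gridVal_succ_aux (n k : ℕ) :
    2 * gridVal G c n k ≤ gridVal G c (n + 1) (2 * k) + c ∧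
      2 * gridVal G c n k ≤ gridVal G c (n + 1) (2 * k + 1) := by
  have odd_of_even : ∀ k, 2 * gridVal G c n k ≤ gridVal G c (n + 1) (2 * k) + c →
      2 * gridVal G c n k ≤ gridVal G c (n + 1) (2 * k + 1) := fun k h => by
    rw [gridVal_succ_succ, gridStep, show (2 * k + 1) / 2 = k by omega]; omega
  induction k with
  | zero => simp [gridVal_zero_right]
  | succ k ih =>
    have h : 2 * gridVal G c n (k + 1) ≤ gridVal G c (n + 1) (2 * (k + 1)) + c := by
      have := gridVal_succ_le (G := G) (c := c) n k
      rw [show 2 * (k + 1) = 2 * k + 1 + 1 by ring, gridVal_succ_succ, gridStep,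
        show (2 * k + 1 + 1) / 2 = k + 1 by omega]
      omega
    exact ⟨h, odd_of_even _ h⟩

lemma coarse_le_gridVal_succ (n j : ℕ) :
    2 * gridVal G c n (j / 2) ≤ gridVal G c (n + 1) j + c := by
  have h := coarse_le_gridVal_succ_aux (G := G) (c := c) n (j / 2)
  rcases Nat.mod_two_eq_zero_or_one j with hj | hj
  · rw [show 2 * (j / 2) = j by omega] at h; omega
  · rw [show 2 * (j / 2) + 1 = j by omega] at h; omega

/-! ### The limit function -/

variable (G c) in
/-- The `n`-th approximation of the limit function. -/
noncomputable def gridApprox (x : ℝ) (n : ℕ) : ℝ := gridVal G c n ⌊2 ^ n * x⌋₊ / 2 ^ n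

variable (G c) in
/-- The limit of the grid functions. -/
noncomputable def gridLimit (x : ℝ) : ℝ := limUnder atTop (gridApprox G c x)

lemma dist_gridApprox_succ_le (x : ℝ) (n : ℕ) :
    dist (gridApprox G c x n) (gridApprox G c x (n + 1)) ≤ (c + 1 : ℝ) / 2 / 2 ^ n := by
  -- Halving the fine index of `x` gives its coarse index, so the level-to-level bounds apply.
  have hfl : ⌊(2 : ℝ) ^ (n + 1) * x⌋₊ / 2 = ⌊(2 : ℝ) ^ n * x⌋₊ := by
    have h := Nat.floor_div_natCast ((2 : ℝ) ^ (n + 1) * x) 2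
    rw [← h]; congr 1; push_cast; ring
  have h1 := gridVal_succ_le_coarse (G := G) (c := c) n ⌊(2 : ℝ) ^ (n + 1) * x⌋₊
  have h2 := coarse_le_gridVal_succ (G := G) (c := c) n ⌊(2 : ℝ) ^ (n + 1) * x⌋₊
  rw [hfl] at h1 h2
  rify at h1 h2
  rw [Real.dist_eq, gridApprox, gridApprox]
  generalize (gridVal G c (n + 1) ⌊(2 : ℝ) ^ (n + 1) * x⌋₊ : ℝ) = a at *
  generalize (gridVal G c n ⌊(2 : ℝ) ^ n * x⌋₊ : ℝ) = b at *
  have hp : (0 : ℝ) < 2 ^ n := by positivity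
  have : b / 2 ^ n - a / 2 ^ (n + 1) = (2 * b - a) / 2 / 2 ^ n := by field_simp; ring
  rw [this, abs_le]
  constructor
  · rw [← neg_div, ← neg_div]; gcongr; linarith
  · gcongr; linarith

lemma tendsto_gridApprox (x : ℝ) :
    Tendsto (gridApprox G c x) atTop (𝓝 (gridLimit G c x)) :=
  (cauchySeq_of_le_geometric_two (dist_gridApprox_succ_le x)).tendsto_limUnder

lemma abs_gridApprox_sub_gridLimit_le (x : ℝ) (n : ℕ) :
    |gridApprox G c x n - gridLimit G c x| ≤ (c + 1 : ℝ) / 2 ^ n :=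
  dist_le_of_le_geometric_two_of_tendsto (dist_gridApprox_succ_le x) (tendsto_gridApprox x) n

lemma gridLimit_mono : Monotone (gridLimit G c) := fun x y hxy => by
  refine le_of_tendsto_of_tendsto' (tendsto_gridApprox x) (tendsto_gridApprox y) fun n => ?_
  have := gridVal_mono (G := G) (c := c) n (Nat.floor_mono (a := 2 ^ n * x) (b := 2 ^ n * y)
    (by gcongr))
  unfold gridApprox
  gcongr

lemma gridLimit_nonneg (x : ℝ) : 0 ≤ gridLimit G c x :=
  ge_of_tendsto' (tendsto_gridApprox x) fun n => by unfold gridApprox; positivity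

lemma tendsto_const_div_two_pow (a : ℝ) : Tendsto (fun n : ℕ => a / 2 ^ n) atTop (𝓝 0) := by
  have := (tendsto_pow_atTop_nhds_zero_of_lt_one (r := (1 / 2 : ℝ)) (by norm_num)
    (by norm_num)).const_mul a
  simpa [div_eq_mul_inv] using this

/-- Rounding `x` and `y` to the grid adds at most one step, hence an error `c / 2 ^ n` that vanishes
in the limit. -/
lemma gridLimit_sub_le {x y : ℝ} (hx : 0 ≤ x) (hxy : x ≤ y) :
    gridLimit G c y - gridLimit G c x ≤ c * (y - x) := by
  have h := (tendsto_const_div_two_pow (c : ℝ)).const_add (c * (y - x))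
  rw [add_zero] at h
  refine le_of_tendsto_of_tendsto' ((tendsto_gridApprox y).sub (tendsto_gridApprox x)) h
    fun n => ?_
  have hp : (0 : ℝ) < 2 ^ n := by positivity
  obtain ⟨k, hk⟩ := Nat.exists_eq_add_of_le
    (Nat.floor_mono (a := 2 ^ n * x) (b := 2 ^ n * y) (by gcongr))
  have h1 := gridVal_add_le (G := G) (c := c) n ⌊2 ^ n * x⌋₊ k
  have h2 := Nat.floor_le (show 0 ≤ 2 ^ n * y by nlinarith)
  have h3 := Nat.lt_floor_add_one (2 ^ n * x)
  unfold gridApprox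
  rw [hk] at h2 ⊢
  rify at h1 h2
  have hk' : (k : ℝ) ≤ 2 ^ n * (y - x) + 1 := by linarith
  have := mul_le_mul_of_nonneg_left hk' (Nat.cast_nonneg (α := ℝ) c)
  rw [← sub_div, div_le_iff₀ hp]
  have e : (c * (y - x) + c / 2 ^ n) * 2 ^ n = c * (2 ^ n * (y - x) + 1) := by
    field_simp
  rw [e]; linarith

lemma lipschitzOnWith_gridLimit : LipschitzOnWith c (gridLimit G c) (Set.Ici 0) := by
  refine LipschitzOnWith.of_le_add_mul _ fun x hx y hy => ?_
  rcases le_total x y with h | h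
  · exact (gridLimit_mono h).trans (le_add_of_nonneg_right (by positivity))
  · have := gridLimit_sub_le (G := G) (c := c) hy h
    rw [Real.dist_eq, abs_of_nonneg (sub_nonneg.2 h)]
    push_cast
    linarith

/-! ### Bounds for the limit function to the left of `β` -/

section Bounds

variable {α β : ℝ}

/-- The clamped value never exceeds the largest of `l`, `2u` and `v`, and all three come from points
left of `β`. -/
lemma gridVal_lt (hα : 0 < α)
    (hG : ∀ n j : ℕ, (j : ℝ) < 2 ^ n * β → (G n j : ℝ) < 2 ^ n * α) (n j : ℕ)
    (hj : (j : ℝ) < 2 ^ n * β) : (gridVal G c n j : ℝ) < 2 ^ n * α := by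
  induction n generalizing j with
  | zero => simpa [gridVal_zero_left] using hα
  | succ n ihn =>
    induction j with
    | zero => simp only [gridVal_zero_right, Nat.cast_zero]; positivity
    | succ j ihj =>
      have h2 : (((j + 1) / 2 : ℕ) : ℝ) * 2 ≤ ((j + 1 : ℕ) : ℝ) := by
        exact_mod_cast Nat.div_mul_le_self _ _
      have h3 := ihn ((j + 1) / 2) (by rw [pow_succ] at hj; nlinarith)
      have h4 := ihj (by push_cast at hj; linarith)
      have h5 := hG (n + 1) (j + 1) hj
      rw [gridVal_succ_succ, gridStep]
      push_cast
      refine max_lt h4 (min_lt_of_left_lt (max_lt ?_ (min_lt_of_left_lt h5)))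
      rw [pow_succ]; linarith

/-- Both caps respect the bound. For `l + c` this is because the line has slope `c`. For `2u + c +
1`, doubling turns the rounding loss `-1` into `-2`, which the `+ 1` repairs, and the `c` covers the
index lost when `j + 1` is odd. The condition `α ≤ c * β` makes the line nonpositive at `0`, where
grid values vanish. -/
lemma le_gridVal (hβ : β ≤ 1) (hc : α ≤ c * β)
    (hG : ∀ n j : ℕ, (j : ℝ) < 2 ^ n * β → 2 ^ n * (α - c * β) + c * j - 1 ≤ (G n j : ℝ))
    (n j : ℕ) (hj : (j : ℝ) < 2 ^ n * β) :
    2 ^ n * (α - c * β) + c * j - 1 ≤ (gridVal G c n j : ℝ) := by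
  induction n generalizing j with
  | zero =>
    have : j = 0 := by
      have : (j : ℝ) < 1 := hj.trans_le (by simpa using hβ)
      exact Nat.lt_one_iff.1 (by exact_mod_cast this)
    subst this
    simp only [pow_zero, gridVal_zero_left, Nat.cast_zero]; linarith
  | succ n ihn =>
    induction j with
    | zero =>
      have : (2 : ℝ) ^ (n + 1) * (α - c * β) ≤ 0 :=
        mul_nonpos_of_nonneg_of_nonpos (by positivity) (by linarith)
      simp only [gridVal_zero_right, Nat.cast_zero]; linarith
    | succ j ihj =>
      have h1 : ((j + 1 : ℕ) : ℝ) ≤ (((j + 1) / 2 : ℕ) : ℝ) * 2 + 1 := by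
        exact_mod_cast (by omega : j + 1 ≤ (j + 1) / 2 * 2 + 1)
      have h2 : (((j + 1) / 2 : ℕ) : ℝ) * 2 ≤ ((j + 1 : ℕ) : ℝ) := by
        exact_mod_cast Nat.div_mul_le_self _ _
      have h3 := ihn ((j + 1) / 2) (by rw [pow_succ] at hj; nlinarith)
      have h4 := ihj (by push_cast at hj; linarith)
      have h5 := hG (n + 1) (j + 1) hj
      have h6 := mul_le_mul_of_nonneg_left h1 (Nat.cast_nonneg (α := ℝ) c)
      rw [gridVal_succ_succ, gridStep]
      push_cast at h5 h6 ⊢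
      refine le_max_of_le_right (le_min (le_max_of_le_right (le_min h5 ?_)) (by linarith))
      rw [pow_succ]; linarith

lemma floor_two_pow_mul_lt {x : ℝ} (hx : 0 ≤ x) (hxβ : x < β) (n : ℕ) :
    (⌊2 ^ n * x⌋₊ : ℝ) < 2 ^ n * β :=
  (Nat.floor_le (by positivity)).trans_lt (by gcongr)

lemma gridLimit_le (hα : 0 < α)
    (hG : ∀ n j : ℕ, (j : ℝ) < 2 ^ n * β → (G n j : ℝ) < 2 ^ n * α) {x : ℝ} (hx : 0 ≤ x)
    (hxβ : x < β) : gridLimit G c x ≤ α :=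
  le_of_tendsto' (tendsto_gridApprox x) fun n => by
    rw [gridApprox, div_le_iff₀' (by positivity)]
    exact (gridVal_lt hα hG n _ (floor_two_pow_mul_lt hx hxβ n)).le

lemma le_gridLimit (hβ : β ≤ 1) (hc : α ≤ c * β)
    (hG : ∀ n j : ℕ, (j : ℝ) < 2 ^ n * β → 2 ^ n * (α - c * β) + c * j - 1 ≤ (G n j : ℝ))
    {x : ℝ} (hx : 0 ≤ x) (hxβ : x < β) : α - c * (β - x) ≤ gridLimit G c x := by
  have h := (tendsto_const_div_two_pow (c + 1 : ℝ)).const_sub (α - c * (β - x))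
  rw [sub_zero] at h
  refine le_of_tendsto_of_tendsto' h (tendsto_gridApprox x) fun n => ?_
  have h1 := le_gridVal hβ hc hG n _ (floor_two_pow_mul_lt hx hxβ n)
  have h2 := mul_le_mul_of_nonneg_left (Nat.lt_floor_add_one (2 ^ n * x)).le
    (Nat.cast_nonneg (α := ℝ) c)
  have hp : (0 : ℝ) < 2 ^ n := by positivity
  rw [gridApprox, le_div_iff₀ hp]
  have e : (α - c * (β - x) - (c + 1) / 2 ^ n) * 2 ^ n
      = 2 ^ n * (α - c * β) + c * (2 ^ n * x) - (c + 1) := by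
    field_simp; ring
  rw [e]; linarith

lemma tendsto_of_lipschitz_lower_bound {f : ℝ → ℝ} {K : ℝ}
    (hle : ∀ x, 0 ≤ x → x < β → f x ≤ α) (hge : ∀ x, 0 ≤ x → x < β → α - K * (β - x) ≤ f x) :
    Tendsto f (𝓝[Set.Ico 0 β] β) (𝓝 α) := by
  have h : Tendsto (fun x => α - K * (β - x)) (𝓝[Set.Ico 0 β] β) (𝓝 α) := by
    have : Continuous fun x : ℝ => α - K * (β - x) := by fun_prop
    simpa using (this.tendsto β).mono_left nhdsWithin_le_nhds
  refine tendsto_of_tendsto_of_tendsto_of_le_of_le' h tendsto_const_nhds ?_ ?_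
  · filter_upwards [self_mem_nhdsWithin] with x hx using hge x hx.1 hx.2
  · filter_upwards [self_mem_nhdsWithin] with x hx using hle x hx.1 hx.2

end Bounds

end Grid

/-! ### Arithmetic on codes of rationals -/

lemma primrec_two_pow : Primrec fun n : ℕ => 2 ^ n :=
  (Primrec.nat_rec₁ 1 (Primrec.nat_mul.comp (Primrec.const 2) Primrec.snd).to₂).of_eq fun n => by
    induction n with
    | zero => rfl
    | succ n ih => simp only [ih, pow_succ]; ring

/-- Codes use reduced fractions, so the gcd has to be primitive recursive; bounded search gives
this. The bound `m + n` also works when one or both arguments are `0`. -/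
lemma gcd_eq_findGreatest (m n : ℕ) :
    Nat.gcd m n = Nat.findGreatest (fun d => m % d = 0 ∧ n % d = 0) (m + n) := by
  symm
  rw [Nat.findGreatest_eq_iff]
  refine ⟨?_, fun _ => ⟨Nat.mod_eq_zero_of_dvd (Nat.gcd_dvd_left m n),
    Nat.mod_eq_zero_of_dvd (Nat.gcd_dvd_right m n)⟩, fun k hk hk' h => ?_⟩
  · rcases Nat.eq_zero_or_pos m with rfl | hm
    · simp
    · exact (Nat.gcd_le_left n hm).trans (Nat.le_add_right m n)
  · have hd := Nat.dvd_gcd (Nat.dvd_of_mod_eq_zero h.1) (Nat.dvd_of_mod_eq_zero h.2)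
    have : 0 < Nat.gcd m n := by
      rw [Nat.gcd_pos_iff]; omega
    exact absurd (Nat.le_of_dvd this hd) (not_le.2 hk)

lemma primrec₂_gcd : Primrec₂ Nat.gcd := by
  have hp : PrimrecRel fun (a : ℕ × ℕ) (d : ℕ) => a.1 % d = 0 ∧ a.2 % d = 0 :=
    (Primrec.eq.comp (Primrec.nat_mod.comp (Primrec.fst.comp Primrec.fst) Primrec.snd)
      (Primrec.const 0)).and
    (Primrec.eq.comp (Primrec.nat_mod.comp (Primrec.snd.comp Primrec.fst) Primrec.snd)
      (Primrec.const 0))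
  exact (Primrec.nat_findGreatest (Primrec.nat_add.comp Primrec.fst Primrec.snd) hp).of_eq
    fun a => (gcd_eq_findGreatest a.1 a.2).symm

lemma ratCode_natCast_div (m d : ℕ) (hd : d ≠ 0) :
    ratCode ((m : ℚ) / d) = Nat.pair (2 * (m / Nat.gcd m d)) (d / Nat.gcd m d) := by
  have h : (m : ℚ) / d = mkRat m d := by rw [Rat.mkRat_eq_div]; simp
  have hn : ((m : ℚ) / d).num = ((m / Nat.gcd m d : ℕ) : ℤ) := by
    rw [h, ← Rat.normalize_eq_mkRat hd, Rat.normalize_eq]; simp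
  have hden : ((m : ℚ) / d).den = d / Nat.gcd m d := by
    rw [h, ← Rat.normalize_eq_mkRat hd, Rat.normalize_eq]; simp
  rw [ratCode, hn, hden]
  rfl

lemma primrec₂_ratCode_dyadic : Primrec₂ fun n j : ℕ => ratCode ((j : ℚ) / (2 : ℚ) ^ n) := by
  have hp : Primrec₂ fun n _ : ℕ => 2 ^ n := primrec_two_pow.comp Primrec.fst
  have hg : Primrec₂ fun n j : ℕ => Nat.gcd j (2 ^ n) :=
    primrec₂_gcd.comp₂ Primrec₂.right hp
  have : Primrec₂ fun n j : ℕ => Nat.pair (2 * (j / Nat.gcd j (2 ^ n))) (2 ^ n / Nat.gcd j (2 ^ n)) :=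
    Primrec₂.natPair.comp₂ (Primrec.nat_double.comp₂ (Primrec.nat_div.comp₂ Primrec₂.right hg))
      (Primrec.nat_div.comp₂ hp hg)
  refine this.of_eq fun n j => ?_
  rw [← ratCode_natCast_div j (2 ^ n) (by positivity)]
  push_cast
  rfl

/-- The natural number floor of `2 ^ n * r`, computed from the code of the rational `r`. -/
def floorCode (n k : ℕ) : ℕ := (1 - k.unpair.1 % 2) * (k.unpair.1 / 2 * 2 ^ n / k.unpair.2)

lemma primrec₂_floorCode : Primrec₂ floorCode := by
  have h1 : Primrec₂ fun _ k : ℕ => k.unpair.1 := (Primrec.fst.comp Primrec.unpair).comp Primrec.snd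
  have h2 : Primrec₂ fun _ k : ℕ => k.unpair.2 := (Primrec.snd.comp Primrec.unpair).comp Primrec.snd
  have hp : Primrec₂ fun n _ : ℕ => 2 ^ n := primrec_two_pow.comp Primrec.fst
  exact Primrec.nat_mul.comp₂
    (Primrec.nat_sub.comp₂ (Primrec₂.const 1) (Primrec.nat_mod.comp₂ h1 (Primrec₂.const 2)))
    (Primrec.nat_div.comp₂ (Primrec.nat_mul.comp₂ (Primrec.nat_div.comp₂ h1 (Primrec₂.const 2)) hp)
      h2)

/-- Integers are encoded as `2m` if nonnegative and as odd numbers if negative. The parity factor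
thus yields `0` for negative rationals, as the natural floor does. -/
lemma floorCode_ratCode (n : ℕ) (r : ℚ) : floorCode n (ratCode r) = ⌊2 ^ n * (r : ℝ)⌋₊ := by
  have hr : (r : ℝ) = r.num / r.den := Rat.cast_def r
  rw [floorCode, ratCode, Nat.unpair_pair]
  rcases hnum : r.num with m | m
  · have he : Encodable.encode (Int.ofNat m) = 2 * m := rfl
    rw [he, hr, hnum, ← mul_div_assoc, Nat.floor_div_natCast]
    have : (2 : ℝ) ^ n * ((Int.ofNat m : ℤ) : ℝ) = ((m * 2 ^ n : ℕ) : ℝ) := by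
      push_cast; simp [mul_comm]
    rw [this, Nat.floor_natCast]
    simp
  · have he : Encodable.encode (Int.negSucc m) = 2 * m + 1 := rfl
    have hneg : (r : ℝ) ≤ 0 := by
      have : r ≤ 0 := Rat.num_nonpos.1 (by rw [hnum]; exact (Int.negSucc_lt_zero m).le)
      exact_mod_cast this
    rw [he, Nat.floor_of_nonpos (mul_nonpos_of_nonneg_of_nonpos (by positivity) hneg)]
    have : (2 * m + 1) % 2 = 1 := by omega
    simp [this]

/-! ### Computing the grid functions -/

lemma primrec_gridStep (c : ℕ) :
    Primrec fun t : ℕ × ℕ × ℕ => gridStep c t.1 t.2.1 t.2.2 := by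
  have hu : Primrec fun t : ℕ × ℕ × ℕ => 2 * t.1 := Primrec.nat_double.comp Primrec.fst
  have hl : Primrec fun t : ℕ × ℕ × ℕ => t.2.1 := Primrec.fst.comp Primrec.snd
  have hv : Primrec fun t : ℕ × ℕ × ℕ => t.2.2 := Primrec.snd.comp Primrec.snd
  have hu' : Primrec fun t : ℕ × ℕ × ℕ => 2 * t.1 + c + 1 :=
    Primrec.succ.comp (Primrec.nat_add.comp hu (Primrec.const c))
  exact Primrec.nat_max.comp hl (Primrec.nat_min.comp
    (Primrec.nat_max.comp hu (Primrec.nat_min.comp hv hu'))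
    (Primrec.nat_add.comp hl (Primrec.const c)))

/-- The body of a recursion: two values of `E`, at arguments given by `a` and `b`, are combined
with a value of `ψ`. -/
def recursionBody {σ : Type*} (E : σ → ℕ →. ℕ) (ψ : ℕ →. ℕ) (a b : ℕ → ℕ) (S : ℕ × ℕ × ℕ → ℕ)
    (e : σ) (k : ℕ) : Part ℕ :=
  (E e (a k)).bind fun u => (E e (b k)).bind fun l => (ψ k).map fun v => S (u, l, v)

lemma partrec₂_recursionBody {σ : Type*} [Primcodable σ] {E : σ → ℕ →. ℕ} (hE : Partrec₂ E)
    {ψ : ℕ →. ℕ} (hψ : Partrec ψ) {a b : ℕ → ℕ} (ha : Computable a) (hb : Computable b)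
    {S : ℕ × ℕ × ℕ → ℕ} (hS : Computable S) : Partrec₂ (recursionBody E ψ a b S) := by
  have h1 : Partrec fun p : σ × ℕ => E p.1 (a p.2) :=
    hE.comp Computable.fst (ha.comp Computable.snd)
  have h2 : Partrec fun p : (σ × ℕ) × ℕ => E p.1.1 (b p.1.2) :=
    hE.comp (Computable.fst.comp Computable.fst)
      (hb.comp (Computable.snd.comp Computable.fst))
  have h3 : Partrec fun p : ((σ × ℕ) × ℕ) × ℕ => ψ p.1.1.2 :=
    hψ.comp (Computable.snd.comp (Computable.fst.comp Computable.fst))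
  have h4 : Computable fun p : (((σ × ℕ) × ℕ) × ℕ) × ℕ => S (p.1.1.2, p.1.2, p.2) :=
    hS.comp ((Computable.snd.comp (Computable.fst.comp Computable.fst)).pair
      ((Computable.snd.comp Computable.fst).pair Computable.snd))
  exact h1.bind (Partrec.to₂ (h2.bind (Partrec.to₂ (h3.map h4.to₂))))

/-- If the data `G n j` can be computed at all grid points up to some point, then so can the grid
function. -/
lemma exists_partrec_gridVal {ψ : ℕ →. ℕ} (hψ : Nat.Partrec ψ) (c : ℕ) :
    ∃ χ : ℕ →. ℕ, Nat.Partrec χ ∧ ∀ (G : ℕ → ℕ → ℕ) (x : ℝ),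
      (∀ n j : ℕ, (j : ℝ) ≤ 2 ^ n * x → G n j ∈ ψ (Nat.pair n j)) →
      ∀ n j : ℕ, (j : ℝ) ≤ 2 ^ n * x → gridVal G c n j ∈ χ (Nat.pair n j) := by
  let T : Nat.Partrec.Code → ℕ →. ℕ :=
    recursionBody Nat.Partrec.Code.eval ψ
      (fun k => Nat.pair (k.unpair.1 - 1) (k.unpair.2 / 2))
      (fun k => Nat.pair k.unpair.1 (k.unpair.2 - 1)) fun t => gridStep c t.1 t.2.1 t.2.2
  -- The product of level and index vanishes exactly in the two base cases of the recursion.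
  let Φ : Nat.Partrec.Code → ℕ →. ℕ := fun e k =>
    Nat.casesOn (k.unpair.1 * k.unpair.2) (Part.some 0) fun _ => T e k
  have hΦ : Partrec₂ Φ := by
    have hn : Primrec fun k : ℕ => k.unpair.1 := Primrec.fst.comp Primrec.unpair
    have hj : Primrec fun k : ℕ => k.unpair.2 := Primrec.snd.comp Primrec.unpair
    have ha : Primrec fun k : ℕ => Nat.pair (k.unpair.1 - 1) (k.unpair.2 / 2) :=
      Primrec₂.natPair.comp (Primrec.nat_sub.comp hn (Primrec.const 1))
        (Primrec.nat_div.comp hj (Primrec.const 2))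
    have hb : Primrec fun k : ℕ => Nat.pair k.unpair.1 (k.unpair.2 - 1) :=
      Primrec₂.natPair.comp hn (Primrec.nat_sub.comp hj (Primrec.const 1))
    have hT : Partrec₂ T := partrec₂_recursionBody Nat.Partrec.Code.eval_part
      (Partrec.nat_iff.2 hψ) ha.to_comp hb.to_comp (primrec_gridStep c).to_comp
    have hk : Primrec fun a : Nat.Partrec.Code × ℕ => a.2.unpair.1 * a.2.unpair.2 :=
      Primrec.nat_mul.comp (hn.comp Primrec.snd) (hj.comp Primrec.snd)
    exact Partrec.nat_casesOn_right hk.to_comp (Computable.const 0)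
      (Partrec.comp hT Computable.fst).to₂
  -- Kleene's recursion theorem yields a program that calls itself at the coarser point and at the
  -- left neighbour. Partial data do no harm, since only points to the left are visited.
  obtain ⟨e, he⟩ := Nat.Partrec.Code.fixed_point₂ hΦ
  refine ⟨e.eval, Nat.Partrec.Code.exists_code.2 ⟨e, rfl⟩, fun G x hG n => ?_⟩
  induction n with
  | zero =>
    intro j _
    rw [he]
    simp [Φ, gridVal_zero_left]
  | succ n ihn =>
    intro j
    induction j with
    | zero =>
      intro _
      rw [he]
      simp [Φ, gridVal_zero_right]
    | succ j ihj =>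
      intro hjx
      have h2 : (((j + 1) / 2 : ℕ) : ℝ) * 2 ≤ ((j + 1 : ℕ) : ℝ) := by
        exact_mod_cast Nat.div_mul_le_self _ _
      have hu := ihn ((j + 1) / 2) (by rw [pow_succ] at hjx; nlinarith)
      have hl := ihj (by push_cast at hjx; linarith)
      have hv := hG _ _ hjx
      rw [he, gridVal_succ_succ]
      have : Φ e (Nat.pair (n + 1) (j + 1)) = T e (Nat.pair (n + 1) (j + 1)) := by
        simp only [Φ, Nat.unpair_pair]
        rw [show (n + 1) * (j + 1) = n * (j + 1) + j + 1 by ring]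
      rw [this]
      simp only [T, recursionBody, Nat.unpair_pair, Nat.add_sub_cancel]
      exact Part.mem_bind hu (Part.mem_bind hl (Part.mem_map _ hv))

/-! ### Effective approximations of the limit function -/

lemma IsEffectiveApprox.abs_sub_le {p : ℕ → ℚ} {x : ℝ} (hp : IsEffectiveApprox p x) (n : ℕ) :
    |(p n : ℝ) - x| ≤ 2 / 2 ^ n := by
  refine dist_le_of_le_geometric_two_of_tendsto (f := fun n => (p n : ℝ)) (fun n => ?_) hp.2 n
  have h := hp.1 n
  rw [Real.dist_eq]
  have : |(p n : ℝ) - p (n + 1)| < (1 / 2) ^ n := by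
    have := (Rat.cast_lt (K := ℝ)).2 h
    push_cast at this
    exact this
  simpa [div_eq_mul_inv] using this.le

/-- A grid index to the left of the real approximated by the rational `r` with error at most
`2 / 2 ^ n`. -/
noncomputable def leftIndex (n : ℕ) (r : ℚ) : ℕ := ⌊2 ^ n * (r : ℝ)⌋₊ - 2

/-- Scaled by `2 ^ n`, the error is at most `2`, so the floors differ by at most `2`. The sign cases
are needed because the natural floor truncates at `0` and does not commute with adding `2` there. -/
lemma leftIndex_bounds {n : ℕ} {r : ℚ} {x : ℝ} (h : |(r : ℝ) - x| ≤ 2 / 2 ^ n) :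
    leftIndex n r ≤ ⌊2 ^ n * x⌋₊ ∧ ⌊2 ^ n * x⌋₊ ≤ leftIndex n r + 4 := by
  have hp : (0 : ℝ) < 2 ^ n := by positivity
  rw [le_div_iff₀ hp, ← abs_of_pos hp, ← abs_mul, abs_le] at h
  have h1 : ⌊2 ^ n * (r : ℝ)⌋₊ ≤ ⌊2 ^ n * x⌋₊ + 2 := by
    rcases le_or_gt 0 (2 ^ n * x) with hx | hx
    · have := Nat.floor_mono (show 2 ^ n * (r : ℝ) ≤ 2 ^ n * x + 2 by linarith)
      rwa [Nat.floor_add_ofNat hx] at this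
    · have := Nat.floor_mono (show 2 ^ n * (r : ℝ) ≤ 2 by linarith)
      rw [Nat.floor_ofNat] at this
      omega
  have h2 : ⌊2 ^ n * x⌋₊ ≤ ⌊2 ^ n * (r : ℝ)⌋₊ + 2 := by
    rcases le_or_gt 0 (2 ^ n * (r : ℝ)) with hx | hx
    · have := Nat.floor_mono (show 2 ^ n * x ≤ 2 ^ n * (r : ℝ) + 2 by linarith)
      rwa [Nat.floor_add_ofNat hx] at this
    · have := Nat.floor_mono (show 2 ^ n * x ≤ 2 by linarith)
      rw [Nat.floor_ofNat] at this
      omega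
  unfold leftIndex
  omega

lemma abs_gridVal_leftIndex_sub_le (G : ℕ → ℕ → ℕ) (c : ℕ) {n : ℕ} {r : ℚ} {x : ℝ}
    (h : |(r : ℝ) - x| ≤ 2 / 2 ^ n) :
    |(gridVal G c n (leftIndex n r) : ℝ) / 2 ^ n - gridLimit G c x| ≤ (5 * c + 1) / 2 ^ n := by
  obtain ⟨h1, h2⟩ := leftIndex_bounds h
  have h3 := gridVal_mono (G := G) (c := c) n h1
  have h4 := (gridVal_mono (G := G) (c := c) n h2).trans (gridVal_add_le n _ 4)
  have h5 := abs_gridApprox_sub_gridLimit_le (G := G) (c := c) x n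
  rify at h3 h4
  have h6 : |(gridVal G c n (leftIndex n r) : ℝ) / 2 ^ n - gridApprox G c x n|
      ≤ 4 * c / 2 ^ n := by
    rw [gridApprox, ← sub_div, abs_div, abs_of_pos (show (0 : ℝ) < 2 ^ n by positivity)]
    gcongr
    rw [abs_le]; constructor <;> linarith
  refine ((abs_sub_le _ _ _).trans (add_le_add h6 h5)).trans_eq ?_
  ring

/-- Consecutive errors add up to `3/4` of `2^(-n)`, which leaves room for the strict inequality. -/
lemma isEffectiveApprox_of_abs_sub_le {q : ℕ → ℚ} {y : ℝ}
    (h : ∀ n, |(q n : ℝ) - y| ≤ 1 / 2 / 2 ^ n) : IsEffectiveApprox q y := by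
  constructor
  · intro n
    have h1 := (abs_sub_le (q n : ℝ) y (q (n + 1))).trans
      (add_le_add (h n) ((abs_sub_comm _ _).trans_le (h (n + 1))))
    have h2 : (1 / 2 / 2 ^ n + 1 / 2 / 2 ^ (n + 1) : ℝ) < (1 / 2) ^ n := by
      rw [one_div_pow, pow_succ]
      have : (0 : ℝ) < 1 / 2 ^ n := by positivity
      field_simp
      norm_num
    rw [← Rat.cast_lt (K := ℝ)]
    push_cast
    exact h1.trans_lt h2
  · rw [tendsto_iff_dist_tendsto_zero]
    exact squeeze_zero (fun _ => dist_nonneg) (fun n => by rw [Real.dist_eq]; exact h n)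
      (tendsto_const_div_two_pow (1 / 2))

/-- One partial recursive function turns the terms of an effective approximation of `x` into those
of an effective approximation of the value of the limit function at `x`, provided that the data can
be computed to the left of `x`. -/
lemma exists_partrec_gridLimit {ψ : ℕ →. ℕ} (hψ : Nat.Partrec ψ) (c : ℕ) :
    ∃ (s : ℕ) (Φ : ℕ →. ℕ), Nat.Partrec Φ ∧ ∀ (G : ℕ → ℕ → ℕ) (x : ℝ), 0 ≤ x →
      (∀ n j : ℕ, (j : ℝ) ≤ 2 ^ n * x → G n j ∈ ψ (Nat.pair n j)) →
      ∀ p : ℕ → ℚ, IsEffectiveApprox p x → ∃ q : ℕ → ℚ,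
        (∀ n, ratCode (q n) ∈ Φ (Nat.pair n (ratCode (p (n + s))))) ∧
          IsEffectiveApprox q (gridLimit G c x) := by
  obtain ⟨χ, hχ, hχG⟩ := exists_partrec_gridVal hψ c
  -- Reading at level `n + s` gives error `(5c + 1) / 2 ^ (n + s)`; this is at most half of `2^(-n)`
  -- because `10c + 2 = s < 2 ^ s`.
  set s := 10 * c + 2 with hs
  refine ⟨s, fun k => (χ (Nat.pair (k.unpair.1 + s) (floorCode (k.unpair.1 + s) k.unpair.2 - 2))).map
    fun a : ℕ => ratCode ((a : ℚ) / (2 : ℚ) ^ (k.unpair.1 + s)), ?_, ?_⟩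
  · have hm : Primrec fun k : ℕ => k.unpair.1 + s :=
      Primrec.nat_add.comp (Primrec.fst.comp Primrec.unpair) (Primrec.const s)
    have hk : Primrec fun k : ℕ => k.unpair.2 := Primrec.snd.comp Primrec.unpair
    have hi : Primrec fun k : ℕ =>
        Nat.pair (k.unpair.1 + s) (floorCode (k.unpair.1 + s) k.unpair.2 - 2) :=
      Primrec₂.natPair.comp hm
        (Primrec.nat_sub.comp (primrec₂_floorCode.comp hm hk) (Primrec.const 2))
    have ho : Primrec₂ fun k a : ℕ => ratCode ((a : ℚ) / (2 : ℚ) ^ (k.unpair.1 + s)) :=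
      primrec₂_ratCode_dyadic.comp (hm.comp Primrec.fst) Primrec.snd
    exact Partrec.nat_iff.1 (((Partrec.nat_iff.2 hχ).comp hi.to_comp).map ho.to_comp)
  · intro G x hx hG p hp
    refine ⟨fun n => (gridVal G c (n + s) (leftIndex (n + s) (p (n + s))) : ℚ) / 2 ^ (n + s),
      fun n => ?_, isEffectiveApprox_of_abs_sub_le fun n => ?_⟩
    · simp only [Nat.unpair_pair, floorCode_ratCode]
      refine Part.mem_map (fun a : ℕ => ratCode ((a : ℚ) / (2 : ℚ) ^ (n + s)))
        (hχG G x hG _ _ ?_)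
      exact (Nat.cast_le.2 (leftIndex_bounds (hp.abs_sub_le (n + s))).1).trans
        (Nat.floor_le (by positivity))
    · have h := abs_gridVal_leftIndex_sub_le G c (hp.abs_sub_le (n + s))
      push_cast
      refine h.trans ?_
      have h2 : ((10 * c + 2 : ℕ) : ℝ) ≤ 2 ^ s := by
        exact_mod_cast (hs ▸ Nat.lt_two_pow_self (n := s)).le
      push_cast at h2
      rw [pow_add, div_le_div_iff₀ (by positivity) (by positivity)]
      nlinarith [show (0 : ℝ) < 2 ^ n by positivity]

/-! ### Oracle machines -/

lemma exists_oracleMachine_of_partrec {φ : ℕ →. ℕ} (hφ : Nat.Partrec φ) :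
    ∃ M : OracleMachine, ∀ O : ℕ → ℕ, M.eval O = φ := by
  induction hφ with
  | zero => exact ⟨.zero, fun _ => rfl⟩
  | succ => exact ⟨.succ, fun _ => rfl⟩
  | left => exact ⟨.left, fun _ => rfl⟩
  | right => exact ⟨.right, fun _ => rfl⟩
  | pair _ _ ihf ihg =>
    obtain ⟨M, hM⟩ := ihf
    obtain ⟨N, hN⟩ := ihg
    refine ⟨.pair M N, fun O => funext fun n => ?_⟩
    simp [OracleMachine.eval, hM, hN, Seq.seq, Part.bind_map]
  | comp _ _ ihf ihg =>
    obtain ⟨M, hM⟩ := ihf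
    obtain ⟨N, hN⟩ := ihg
    refine ⟨.comp M N, fun O => funext fun n => ?_⟩
    simp only [OracleMachine.eval, hM, hN]
    rfl
  | prec _ _ ihf ihg =>
    obtain ⟨M, hM⟩ := ihf
    obtain ⟨N, hN⟩ := ihg
    refine ⟨.prec M N, fun O => funext fun n => ?_⟩
    simp [OracleMachine.eval, hM, hN, Nat.unpaired]
  | rfind _ ihf =>
    obtain ⟨M, hM⟩ := ihf
    refine ⟨.rfind M, fun O => funext fun n => ?_⟩
    simp [OracleMachine.eval, hM]

/-- A partial recursive function applied to the argument and to one term of the input sequence. -/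
lemma exists_oracleMachine_query {Φ : ℕ →. ℕ} (hΦ : Nat.Partrec Φ) (s : ℕ) :
    ∃ M : OracleMachine, ∀ (O : ℕ → ℕ) (n : ℕ), M.eval O n = Φ (Nat.pair n (O (n + s))) := by
  obtain ⟨M, hM⟩ := exists_oracleMachine_of_partrec hΦ
  obtain ⟨I, hI⟩ := exists_oracleMachine_of_partrec Nat.Partrec.some
  obtain ⟨S, hS⟩ := exists_oracleMachine_of_partrec (φ := fun n => Part.some (n + s))
    (Partrec.nat_iff.1 (Primrec.nat_add.comp Primrec.id (Primrec.const s)).to_comp)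
  exact ⟨.comp M (.pair I (.comp .oracle S)), fun O n => by 
    simp only [OracleMachine.eval, hM, hI, hS, Part.bind_some, Part.map_some]
    exact Part.bind_some _ _⟩

/-! ### The data given by a translation function -/

open Classical in
/-- The value of `g` at `j / 2 ^ n`, scaled by `2 ^ n` and rounded down; the index is reduced modulo
`2 ^ n` so that the argument lies in `[0,1)`. -/
noncomputable def gridData (g : ℚ →. ℚ) (n j : ℕ) : ℕ :=
  if h : (g (((j % 2 ^ n : ℕ) : ℚ) / 2 ^ n)).Dom then ⌊2 ^ n * (((g _).get h : ℚ) : ℝ)⌋₊ else 0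

lemma gridData_eq {g : ℚ →. ℚ} {n j : ℕ} {r : ℚ} (h : r ∈ g (((j % 2 ^ n : ℕ) : ℚ) / 2 ^ n)) :
    gridData g n j = ⌊2 ^ n * (r : ℝ)⌋₊ := by
  obtain ⟨hd, hr⟩ := h
  rw [gridData, dif_pos hd, hr]

lemma exists_partrec_gridData {g : ℚ →. ℚ} (hg : PartialComputable g) :
    ∃ ψ : ℕ →. ℕ, Nat.Partrec ψ ∧ ∀ n j : ℕ, (g (((j % 2 ^ n : ℕ) : ℚ) / 2 ^ n)).Dom →
      gridData g n j ∈ ψ (Nat.pair n j) := by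
  obtain ⟨φ, hφ, hφg⟩ := hg
  refine ⟨fun k => (φ (ratCode (((k.unpair.2 % 2 ^ k.unpair.1 : ℕ) : ℚ) / 2 ^ k.unpair.1))).map
    fun v => floorCode k.unpair.1 v, ?_, fun n j hd => ?_⟩
  · have hn : Primrec fun k : ℕ => k.unpair.1 := Primrec.fst.comp Primrec.unpair
    have hj : Primrec fun k : ℕ => k.unpair.2 := Primrec.snd.comp Primrec.unpair
    have hi : Primrec fun k : ℕ =>
        ratCode (((k.unpair.2 % 2 ^ k.unpair.1 : ℕ) : ℚ) / 2 ^ k.unpair.1) :=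
      primrec₂_ratCode_dyadic.comp hn (Primrec.nat_mod.comp hj (primrec_two_pow.comp hn))
    have ho : Primrec₂ fun k v : ℕ => floorCode k.unpair.1 v :=
      primrec₂_floorCode.comp (hn.comp Primrec.fst) Primrec.snd
    exact Partrec.nat_iff.1 (((Partrec.nat_iff.2 hφ).comp hi.to_comp).map ho.to_comp)
  · have hr := Part.get_mem hd
    rw [gridData_eq hr, ← floorCode_ratCode]
    simp only [Nat.unpair_pair]
    refine Part.mem_map _ ?_
    rw [hφg]
    exact Part.mem_map _ hr

section Translation

variable {g : ℚ →. ℚ} {α β : ℝ}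

lemma IsQTranslation.le_one (hg : IsQTranslation g β α) : β ≤ 1 := by
  by_contra! h
  have hd := hg.dom_of_mem_leftCut 1 ⟨zero_le_one, by simpa using h⟩
  exact absurd (hg.mem_unit _ _ (Part.get_mem hd)).1.2 (lt_irrefl _)

lemma IsQTranslation.pos (hg : IsQTranslation g β α) (hβ : 0 < β) : 0 < α := by
  have h0 : (0 : ℚ) ∈ leftCut β := ⟨le_rfl, by simpa using hβ⟩
  have hr := Part.get_mem (hg.dom_of_mem_leftCut 0 h0)
  have h1 : (0 : ℝ) ≤ _ := Rat.cast_nonneg.2 (hg.mem_unit _ _ hr).2.1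
  exact h1.trans_lt (hg.lt_of_mem_leftCut 0 h0 _ hr)

lemma dyadic_mem_leftCut (hβ : β ≤ 1) {n j : ℕ} (hj : (j : ℝ) < 2 ^ n * β) :
    j % 2 ^ n = j ∧ ((j % 2 ^ n : ℕ) : ℚ) / 2 ^ n ∈ leftCut β := by
  have hp : (0 : ℝ) < 2 ^ n := by positivity
  have h : j < 2 ^ n := by
    have : (j : ℝ) < 2 ^ n := by nlinarith
    exact_mod_cast this
  refine ⟨Nat.mod_eq_of_lt h, by positivity, ?_⟩
  rw [Nat.mod_eq_of_lt h]
  push_cast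
  rwa [div_lt_iff₀' hp]

lemma IsQTranslation.gridData_lt (hg : IsQTranslation g β α) (n j : ℕ)
    (hj : (j : ℝ) < 2 ^ n * β) : (gridData g n j : ℝ) < 2 ^ n * α := by
  obtain ⟨-, hq⟩ := dyadic_mem_leftCut hg.le_one hj
  have hr := Part.get_mem (hg.dom_of_mem_leftCut _ hq)
  have h0 : (0 : ℝ) ≤ _ := Rat.cast_nonneg.2 (hg.mem_unit _ _ hr).2.1
  rw [gridData_eq hr]
  refine (Nat.floor_le (by positivity)).trans_lt ?_
  gcongr
  exact hg.lt_of_mem_leftCut _ hq _ hr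

lemma IsQTranslation.le_gridData (hg : IsQTranslation g β α) {c : ℕ}
    (hc : ∀ q ∈ leftCut β, ∀ r ∈ g q, α - (r : ℝ) ≤ c * (β - (q : ℝ))) (n j : ℕ)
    (hj : (j : ℝ) < 2 ^ n * β) : 2 ^ n * (α - c * β) + c * j - 1 ≤ (gridData g n j : ℝ) := by
  obtain ⟨hmod, hq⟩ := dyadic_mem_leftCut hg.le_one hj
  have hr := Part.get_mem (hg.dom_of_mem_leftCut _ hq)
  rw [gridData_eq hr]
  have h1 := hc _ hq _ hr
  have hp : (0 : ℝ) < 2 ^ n := by positivity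
  have h2 := mul_le_mul_of_nonneg_left h1 hp.le
  have h3 := (Nat.lt_floor_add_one (2 ^ n * (((g _).get (hg.dom_of_mem_leftCut _ hq) : ℚ) : ℝ))).le
  have e : (2 : ℝ) ^ n * (c * (β - ((((j % 2 ^ n : ℕ) : ℚ) / 2 ^ n : ℚ) : ℝ)))
      = 2 ^ n * (c * β) - c * j := by
    rw [hmod]; push_cast; field_simp
  rw [e] at h2
  linarith

/-- The limit function built from a translation function lies between `α - c (β - x)` and `α` to the
left of `β`. -/
lemma SolovayReducibleVia.exists_gridLimit (h : SolovayReducibleVia g α β) (hβ : 0 < β) :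
    ∃ c : ℕ, (∀ x, 0 ≤ x → x < β → gridLimit (gridData g) c x ≤ α) ∧
      ∀ x, 0 ≤ x → x < β → α - c * (β - x) ≤ gridLimit (gridData g) c x := by
  obtain ⟨hg, c₀, hc₀⟩ := h
  -- Besides dominating `c₀`, the constant must satisfy `α ≤ c * β`, since the limit function starts
  -- at `0`.
  obtain ⟨c, hc⟩ := exists_nat_ge (max c₀ (α / β))
  have hc1 : c₀ ≤ c := (le_max_left _ _).trans hc
  have hc2 : α ≤ c * β := (div_le_iff₀ hβ).1 ((le_max_right _ _).trans hc)
  refine ⟨c, fun x hx hxβ => gridLimit_le (hg.pos hβ) hg.gridData_lt hx hxβ, fun x hx hxβ =>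
    le_gridLimit hg.le_one hc2 (hg.le_gridData fun q hq r hr => (hc₀ q hq r hr).le.trans ?_) hx hxβ⟩
  have : 0 ≤ β - (q : ℝ) := sub_nonneg.2 hq.2.le
  gcongr

/-! ### Computability of the limit function and the resulting reductions -/

lemma computableOn_of_partrec {f : ℝ → ℝ} {X : Set ℝ} {s : ℕ} {Φ : ℕ →. ℕ} (hΦ : Nat.Partrec Φ)
    (h : ∀ x ∈ X, ∀ p : ℕ → ℚ, IsEffectiveApprox p x → ∃ q : ℕ → ℚ,
      (∀ n, ratCode (q n) ∈ Φ (Nat.pair n (ratCode (p (n + s))))) ∧ IsEffectiveApprox q (f x)) :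
    ComputableOn f X := by
  obtain ⟨M, hM⟩ := exists_oracleMachine_query hΦ s
  refine ⟨M, fun x hx p hp => ?_⟩
  obtain ⟨q, hq, hq'⟩ := h x hx p hp
  exact ⟨q, fun n => by rw [hM]; exact hq n, hq'⟩

lemma isEffectiveApprox_const (r : ℚ) : IsEffectiveApprox (fun _ => r) (r : ℝ) :=
  ⟨fun n => by simp, tendsto_const_nhds⟩

/-- A rational has a constant approximation, so the oracle query can be replaced by a fixed code. -/
lemma computableReal_of_partrec {y : ℝ} {r : ℚ} {s : ℕ} {Φ : ℕ →. ℕ} (hΦ : Nat.Partrec Φ)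
    (h : ∀ p : ℕ → ℚ, IsEffectiveApprox p (r : ℝ) → ∃ q : ℕ → ℚ,
      (∀ n, ratCode (q n) ∈ Φ (Nat.pair n (ratCode (p (n + s))))) ∧ IsEffectiveApprox q y) :
    ComputableReal y := by
  obtain ⟨q, hq, hq'⟩ := h _ (isEffectiveApprox_const r)
  have hpair : Primrec fun n : ℕ => Nat.pair n (ratCode r) :=
    Primrec₂.natPair.comp Primrec.id (Primrec.const _)
  exact ⟨q, ((Partrec.nat_iff.2 hΦ).comp hpair.to_comp).of_eq_tot hq, hq'⟩

/-- The grid limit is computable on every set of nonnegative reals to the left of which `g` is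
defined, and its values at rationals of such a set are computable. -/
lemma computable_gridLimit (hg : PartialComputable g) (c : ℕ) {X : Set ℝ}
    (hX : ∀ x ∈ X, 0 ≤ x) (hdom : ∀ x ∈ X, ∀ n j : ℕ, (j : ℝ) ≤ 2 ^ n * x →
      (g (((j % 2 ^ n : ℕ) : ℚ) / 2 ^ n)).Dom) :
    ComputableOn (gridLimit (gridData g) c) X ∧
      ∀ r : ℚ, (r : ℝ) ∈ X → ComputableReal (gridLimit (gridData g) c r) := by
  obtain ⟨ψ, hψ, hψg⟩ := exists_partrec_gridData hg
  obtain ⟨s, Φ, hΦ, h⟩ := exists_partrec_gridLimit hψ c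
  have h' : ∀ x ∈ X, ∀ p : ℕ → ℚ, IsEffectiveApprox p x → ∃ q : ℕ → ℚ,
      (∀ n, ratCode (q n) ∈ Φ (Nat.pair n (ratCode (p (n + s))))) ∧
        IsEffectiveApprox q (gridLimit (gridData g) c x) := fun x hx =>
    h (gridData g) x (hX x hx) fun n j hj => hψg n j (hdom x hx n j hj)
  exact ⟨computableOn_of_partrec hΦ h', fun r hr => computableReal_of_partrec hΦ (h' r hr)⟩

lemma IsQTranslation.dom_dyadic (hg : IsQTranslation g β α) :
    ∀ x ∈ Set.Ico 0 β, ∀ n j : ℕ, (j : ℝ) ≤ 2 ^ n * x →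
      (g (((j % 2 ^ n : ℕ) : ℚ) / 2 ^ n)).Dom := fun x hx n j hj =>
  hg.dom_of_mem_leftCut _
    (dyadic_mem_leftCut hg.le_one (hj.trans_lt (by have := hx.2; gcongr))).2

lemma isRTranslation_of_nonpos (hβ : β ≤ 0) : IsRTranslation (fun _ => 0) β α := by
  have h : Set.Ico 0 β = ∅ := Set.Ico_eq_empty (not_lt.2 hβ)
  refine ⟨⟨⟨.zero, ?_⟩, ?_⟩, ?_⟩ <;> simp [h, Set.MapsTo]

/-- A Solovay reduction yields a Lipschitz continuous weakly `ℝ`-translation function, which is an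
`ℝ`-translation function if `α` is not computable. -/
lemma SolovayReducible.exists_isWeakRTranslation (h : SolovayReducible α β) :
    ∃ f : ℝ → ℝ, IsWeakRTranslation f β α ∧ (∃ K : ℝ≥0, LipschitzOnWith K f (Set.Ico 0 β)) ∧
      (¬ ComputableReal α → Set.MapsTo f (Set.Ico 0 β) (Set.Ico 0 α)) := by
  rcases le_or_gt β 0 with hβ | hβ
  · have h0 := isRTranslation_of_nonpos (α := α) hβ
    exact ⟨_, h0.toIsWeakRTranslation, ⟨0, (LipschitzWith.const 0).lipschitzOnWith⟩, fun _ => h0.mapsTo⟩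
  obtain ⟨g, hg⟩ := h
  obtain ⟨c, hle, hge⟩ := hg.exists_gridLimit hβ
  obtain ⟨hcomp, hreal⟩ := computable_gridLimit hg.1.partialComputable c
    (fun x (hx : x ∈ Set.Ico 0 β) => hx.1) hg.1.dom_dyadic
  refine ⟨gridLimit (gridData g) c, ⟨hcomp, tendsto_of_lipschitz_lower_bound hle hge⟩,
    ⟨c, lipschitzOnWith_gridLimit.mono Set.Ico_subset_Ici_self⟩, fun hα x hx =>
    ⟨gridLimit_nonneg x, (hle x hx.1 hx.2).lt_of_ne fun hx' => hα ?_⟩⟩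
  -- If `α` is attained at `x`, then by monotonicity also at a rational `r` between `x` and `β`,
  -- where the value is computable.
  obtain ⟨r, hxr, hrβ⟩ := exists_rat_btwn hx.2
  have hr : (r : ℝ) ∈ Set.Ico 0 β := ⟨hx.1.trans hxr.le, hrβ⟩
  have : gridLimit (gridData g) c r = α :=
    le_antisymm (hle r hr.1 hr.2) (hx' ▸ gridLimit_mono hxr.le)
  exact this ▸ hreal r hr

lemma TotalSolovayReducible.clLocalReducible (hβ : 0 < β) (h : TotalSolovayReducible α β) :
    CLLocalReducible α β := by
  obtain ⟨g, hg, htot⟩ := h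
  obtain ⟨c, hle, hge⟩ := hg.exists_gridLimit hβ
  have hlip := lipschitzOnWith_gridLimit (G := gridData g) (c := c)
  -- Reducing the index modulo `2 ^ n` keeps the argument in `[0,1)`, so totality supplies data at
  -- every grid point, even beyond `1`. Any endpoint `b > β` would then do.
  have hdom : ∀ n j : ℕ, (g (((j % 2 ^ n : ℕ) : ℚ) / 2 ^ n)).Dom := fun n j => by
    refine htot _ ⟨by positivity, ?_⟩
    rw [div_lt_one (by positivity)]
    exact_mod_cast Nat.mod_lt j (by positivity)
  refine ⟨β + 1, lt_add_one β, gridLimit (gridData g) c,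
    (computable_gridLimit hg.1.partialComputable c (fun x hx => hx.1) fun _ _ n j _ =>
      hdom n j).1, ⟨c, hlip.mono Set.Icc_subset_Ici_self⟩, ?_⟩
  -- Here `β > 0` enters: `β` is a limit point of `[0,β)`, so the value at `β`, given by continuity,
  -- must equal the left limit `α`.
  have hne : (𝓝[Set.Ico 0 β] β).NeBot := by
    rw [← mem_closure_iff_nhdsWithin_neBot, closure_Ico hβ.ne]
    exact ⟨hβ.le, le_rfl⟩
  exact tendsto_nhds_unique
    ((hlip.continuousOn β hβ.le).mono_left (nhdsWithin_mono _ Set.Ico_subset_Ici_self))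
    (tendsto_of_lipschitz_lower_bound hle hge)

end Translation

end SolovayVariants

theorem theorem3p1 (α β : ℝ) :
    (SolovayVariants.SolovayReducible α β → SolovayVariants.CLOpenReducible α β) ∧
    (0 < β → SolovayVariants.TotalSolovayReducible α β →
      SolovayVariants.CLLocalReducible α β) ∧
    (¬ SolovayVariants.ComputableReal α → SolovayVariants.SolovayReducible α β →
      SolovayVariants.RealSolovayReducible α β) := by
  refine ⟨fun h => ?_, fun hβ h => h.clLocalReducible hβ, fun hα h => ?_⟩
  · obtain ⟨f, hf, hK, -⟩ := h.exists_isWeakRTranslation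
    exact ⟨f, hf, hK⟩
  · obtain ⟨f, hf, hK, hmaps⟩ := h.exists_isWeakRTranslation
    exact ⟨f, ⟨hf, hmaps hα⟩, hK⟩
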